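/- **Inner layer.** Let $\mathtt{Prop}$ be a countable set of variables and let $\mathscr{L}_{\mathsf{BD}}$ be given by $\phi ::= p\mid\neg\phi\mid\phi\wedge\phi\mid\phi\vee\phi$. A BD model is $\langle W,v^+,v^-\rangle$ with $W\neq\varnothing$ and $v^\pm:\mathtt{Prop}\to\mathcal P(W)$; put $w\vDash^{\pm}p$ iff $w\in v^\pm(p)$; $w\vDash^{\pm}\neg\phi$ iff $w\vDash^{\mp}\phi$; $w\vDash^+\phi\wedge\chi$ iff $w\vDash^+\phi$ and $w\vDash^+\chi$; $w\vDash^-\phi\wedge\chi$ iff $w\vDash^-\phi$ or $w\vDash^-\chi$; and dually for $\vee$. Let $|\phi|^\pm=\{w: w\vDash^\pm\phi\}$. The sequent $\phi\vdash\chi$ is BD valid if $|\phi|^+\subseteq|\chi|^+$ and $|\chi|^-\subseteq|\phi|^-$ in every BD model. **Outer layer.** $\mathscr{L}_{\mathsf{MCB}}$ is built from atoms $\mathtt C\phi$ ($\phi\in\mathscr{L}_{\mathsf{BD}}$) with $\neg,\wedge,\vee,\to,\prec$ (co-implication), and $\mathscr{L}_{\mathsf{NMCB}}$ from the same atoms with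 $\neg,\wedge,\vee,\rightarrowtriangle,\multimap$. A model is a BD model with an uncertainty measure $\pi:\mathcal P(W)\to[0,1]$, i.e. $X\subseteq Y$ implies $\pi(X)\le\pi(Y)$, and $\pi(\varnothing)<\pi(W)$. On $[0,1]$ let $a\to_{\mathsf G}b=1$ if $a\le b$ and $=b$ otherwise, and $b \prec_{\mathsf G}a=0$ if $b\le a$ and $=b$ otherwise. Each model determines $e_1,e_2$: $e_1(\mathtt C\phi)=\pi(|\phi|^+)$, $e_2(\mathtt C\phi)=\pi(|\phi|^-)$; $e_1(\neg\alpha)=e_2(\alpha)$, $e_2(\neg\alpha)=e_1(\alpha)$; $e_1$ takes $\wedge,\vee$ to $\min,\max$ and $e_2$ takes them to $\max,\min$; $e_1$ takes both implications to $\to_{\mathsf G}$ and both co-implications to $ \prec_{\mathsf G}$; and $$e_2(\alpha\to\beta)=e_2(\beta) \prec_{\mathsf G}e_2(\alpha),\quad e_2(\alpha \prec \beta)=e_2(\beta)\to_{\mathsf G}e_2(\alpha),$$ $$e_2(\alpha\rightarrowtriangle\beta)=\min(e_1(\alpha),e_2(\beta)),\quad e_2(\alpha\multimap\beta)=\max(e_2(\alpha),e_1(\beta)).$$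 $\Psi\models_{\mathsf{MCB}}\alpha$ means that $\inf_{\psi\in\Psi}e_1(\psi)\le e_1(\alpha)$ and $\sup_{\psi\in\Psi}e_2(\psi)\ge e_2(\alpha)$ in every model; $\Omega\models_{\mathsf{NMCB}}\beta$ means that $\inf_{\omega\in\Omega}e_1(\omega)\le e_1(\beta)$ in every model (infima and suprema in $[0,1]$). **Calculi.** $\mathcal H\mathsf{MCB}$ has the following axioms, for all $\mathscr{L}_{\mathsf{MCB}}$ formulas $\alpha,\beta,\gamma,\tau$ and $\phi,\chi\in\mathscr{L}_{\mathsf{BD}}$, where $\top=\tau\to\tau$, $\bot=\tau \prec \tau$, ${\sim}\alpha=\alpha\to\bot$ and $\alpha\leftrightarrow\beta=(\alpha\to\beta)\wedge(\beta\to\alpha)$: 1. $(\alpha\to\beta)\to((\beta\to\gamma)\to(\alpha\to\gamma))$; 2. $\alpha\to(\alpha\vee\beta)$; $\beta\to(\alpha\vee\beta)$; $(\alpha\to\gamma)\to((\beta\to\gamma)\to((\alpha\vee\beta)\to\gamma))$; 3. $(\alpha\wedge\beta)\to\alpha$; $(\alpha\wedge\beta)\to\beta$; $(\alpha\to\beta)\to((\alpha\to\gamma)\to(\alpha\to(\beta\wedge\gamma)))$;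 4. $(\alpha\to(\beta\to\gamma))\to((\alpha\wedge\beta)\to\gamma)$; $((\alpha\wedge\beta)\to\gamma)\to(\alpha\to(\beta\to\gamma))$; 5. $(\alpha\to\beta)\to({\sim}\beta\to{\sim}\alpha)$; 6. $(\alpha \prec \beta)\to(\top \prec (\alpha\to\beta))$; ${\sim}(\alpha \prec \beta)\to(\alpha\to\beta)$; 7. $\alpha\to(\beta\vee(\alpha \prec \beta))$; $((\alpha \prec \beta) \prec \gamma)\to(\alpha \prec (\beta\vee\gamma))$; 8. (prelinearity) $(\alpha\to\beta)\vee(\beta\to\alpha)$; ${\sim}((\alpha \prec \beta)\wedge(\beta \prec \alpha))$; 9. $\neg\neg\alpha\leftrightarrow\alpha$; $\neg(\alpha\wedge\beta)\leftrightarrow(\neg\alpha\vee\neg\beta)$; $\neg(\alpha\vee\beta)\leftrightarrow(\neg\alpha\wedge\neg\beta)$; 10. $\neg(\alpha\to\beta)\leftrightarrow(\neg\beta \prec \neg\alpha)$; $\neg(\alpha \prec \beta)\leftrightarrow(\neg\beta\to\neg\alpha)$; 11. $\mathtt C\phi\to\mathtt C\chi$ whenever $\phi\vdash\chi$ is BD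 valid; $\mathtt C\neg\phi\leftrightarrow\neg\mathtt C\phi$. The rules are modus ponens and, applied to theorems only, necessitation: from $\vdash\alpha$ infer $\vdash(\top \prec \alpha)\to\bot$. $\mathcal H\mathsf{NMCB}$ is obtained by writing $\rightarrowtriangle,\multimap$ for $\to,\prec$ (co-implication) in 1–9 and in the rules, and replacing 10 and 11 by $\neg(\alpha\rightarrowtriangle\beta)\leftrightarrowtriangle(\alpha\wedge\neg\beta)$; $\neg(\alpha\multimap\beta)\leftrightarrowtriangle(\neg\alpha\vee\beta)$; $\mathtt C\phi\Rightarrow\mathtt C\chi$ whenever $\phi\vdash\chi$ is BD valid; $\mathtt C\neg\phi\Leftrightarrow\neg\mathtt C\phi$. Here $\alpha\leftrightarrowtriangle\beta=(\alpha\rightarrowtriangle\beta)\wedge(\beta\rightarrowtriangle\alpha)$, $\alpha\Rightarrow\beta=(\alpha\rightarrowtriangle\beta)\wedge(\neg\beta\rightarrowtriangle\neg\alpha)$ and $\alpha\Leftrightarrow\beta=(\alpha\Rightarrow\beta)\wedge(\beta\Rightarrow\alpha)$. **Theorem (strong soundness and completeness).** For all (possibly infinite) $\Psi\cup\{\alpha\}\subseteq\mathscr{L}_{\mathsf{MCB}}$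 and $\Omega\cup\{\beta\}\subseteq\mathscr{L}_{\mathsf{NMCB}}$, $$\Psi\vdash_{\mathcal H\mathsf{MCB}}\alpha\iff\Psi\models_{\mathsf{MCB}}\alpha,\qquad \Omega\vdash_{\mathcal H\mathsf{NMCB}}\beta\iff\Omega\models_{\mathsf{NMCB}}\beta.$$ -/

import Mathlib

open scoped unitInterval

universe u

/-! ## Belnap–Dunn logic (the inner layer) -/

/-- Formulas of `BD` over a set `P` of propositional variables. -/
inductive BDForm (P : Type u) : Type u where
  | var : P → BDForm P
  | neg : BDForm P → BDForm P
  | and : BDForm P → BDForm P → BDForm P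
  | or : BDForm P → BDForm P → BDForm P

/-- Belnap–Dunn models `⟨W, v⁺, v⁻⟩` with `W ≠ ∅`. -/
structure BDModel (P : Type u) where
  W : Type u
  nonempty : Nonempty W
  vpos : P → Set W
  vneg : P → Set W

/-- The pair `(w ⊨⁺ φ, w ⊨⁻ φ)` of positive and negative support. -/
def BDModel.support {P : Type u} (M : BDModel P) (w : M.W) : BDForm P → Prop × Prop
  | .var p => (w ∈ M.vpos p, w ∈ M.vneg p)
  | .neg φ => ((M.support w φ).2, (M.support w φ).1)
  | .and φ ψ =>
      ((M.support w φ).1 ∧ (M.support w ψ).1, (M.support w φ).2 ∨ (M.support w ψ).2)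
  | .or φ ψ =>
      ((M.support w φ).1 ∨ (M.support w ψ).1, (M.support w φ).2 ∧ (M.support w ψ).2)

/-- The positive interpretation `|φ|⁺`. -/
def BDModel.posExt {P : Type u} (M : BDModel P) (φ : BDForm P) : Set M.W :=
  {w | (M.support w φ).1}

/-- The negative interpretation `|φ|⁻`. -/
def BDModel.negExt {P : Type u} (M : BDModel P) (φ : BDForm P) : Set M.W :=
  {w | (M.support w φ).2}

/-- The sequent `φ ⊢ χ` is `BD` valid, i.e. valid on every Belnap–Dunn model. -/
def BDValid {P : Type u} (φ χ : BDForm P) : Prop :=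
  ∀ M : BDModel P, ∀ w : M.W,
    (w ∈ M.posExt φ → w ∈ M.posExt χ) ∧ (w ∈ M.negExt χ → w ∈ M.negExt φ)

/-! ## The outer layer -/

/-- Outer-layer formulas. The languages of `MCB` and `NMCB` have the same signature
`C φ, ¬, ∧, ∨`, one implication and one co-implication, and differ only in the name and the
meaning of the last two: `imp`, `coimp` are read as `→`, `⤙` in `MCB`
and as `⤏`, `⊸` in `NMCB`. -/
inductive OuterForm (P : Type u) : Type u where
  | C : BDForm P → OuterForm P
  | neg : OuterForm P → OuterForm P
  | and : OuterForm P → OuterForm P → OuterForm P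
  | or : OuterForm P → OuterForm P → OuterForm P
  | imp : OuterForm P → OuterForm P → OuterForm P
  | coimp : OuterForm P → OuterForm P → OuterForm P

/-- The language of `MCB` (`imp` is `→`, `coimp` is `⤙`). -/
abbrev LMCB (P : Type u) : Type u := OuterForm P

/-- The language of `NMCB` (`imp` is `⤏`, `coimp` is `⊸`). -/
abbrev LNMCB (P : Type u) : Type u := OuterForm P

/-! ### Semantics -/

/-- Gödel implication on `[0,1]`. -/
noncomputable def gImp (a b : I) : I := if a ≤ b then 1 else b

/-- Gödel co-implication on `[0,1]`: `gCoimp b a` is `b ⤙ a`. -/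
noncomputable def gCoimp (b a : I) : I := if b ≤ a then 0 else b

/-- Models of `MCB` and `NMCB`: a Belnap–Dunn model with an uncertainty measure, i.e. a
monotone non-trivial map from the power set of `W` to `[0,1]`. The valuations `e₁`, `e₂` are
determined by these data. -/
structure BeliefModel (P : Type u) extends BDModel P where
  π : Set W → I
  mono : ∀ X Y : Set W, X ⊆ Y → π X ≤ π Y
  nontriv : π ∅ < π Set.univ

/-- The pair `(e₁ α, e₂ α)` for `α` in the language of `MCB`. -/
noncomputable def BeliefModel.valMCB {P : Type u} (M : BeliefModel P) : LMCB P → I × I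
  | .C φ => (M.π (M.posExt φ), M.π (M.negExt φ))
  | .neg α => ((M.valMCB α).2, (M.valMCB α).1)
  | .and α β => (min (M.valMCB α).1 (M.valMCB β).1, max (M.valMCB α).2 (M.valMCB β).2)
  | .or α β => (max (M.valMCB α).1 (M.valMCB β).1, min (M.valMCB α).2 (M.valMCB β).2)
  | .imp α β =>
      (gImp (M.valMCB α).1 (M.valMCB β).1, gCoimp (M.valMCB β).2 (M.valMCB α).2)
  | .coimp α β =>
      (gCoimp (M.valMCB α).1 (M.valMCB β).1, gImp (M.valMCB β).2 (M.valMCB α).2)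

/-- The pair `(e₁ α, e₂ α)` for `α` in the language of `NMCB`. -/
noncomputable def BeliefModel.valNMCB {P : Type u} (M : BeliefModel P) : LNMCB P → I × I
  | .C φ => (M.π (M.posExt φ), M.π (M.negExt φ))
  | .neg α => ((M.valNMCB α).2, (M.valNMCB α).1)
  | .and α β => (min (M.valNMCB α).1 (M.valNMCB β).1, max (M.valNMCB α).2 (M.valNMCB β).2)
  | .or α β => (max (M.valNMCB α).1 (M.valNMCB β).1, min (M.valNMCB α).2 (M.valNMCB β).2)
  | .imp α β =>
      (gImp (M.valNMCB α).1 (M.valNMCB β).1, min (M.valNMCB α).1 (M.valNMCB β).2)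
  | .coimp α β =>
      (gCoimp (M.valNMCB α).1 (M.valNMCB β).1, max (M.valNMCB α).2 (M.valNMCB β).1)

/-- Entailment of `MCB`. Infima and suprema are taken in `[0,1]`, so the empty infimum is `1`
and the empty supremum is `0`. -/
def MCBEntails {P : Type u} (Ψ : Set (LMCB P)) (α : LMCB P) : Prop :=
  ∀ M : BeliefModel P,
    (⨅ ψ ∈ Ψ, (M.valMCB ψ).1) ≤ (M.valMCB α).1 ∧ (M.valMCB α).2 ≤ ⨆ ψ ∈ Ψ, (M.valMCB ψ).2

/-- Entailment of `NMCB`. -/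
def NMCBEntails {P : Type u} (Ω : Set (LNMCB P)) (β : LNMCB P) : Prop :=
  ∀ M : BeliefModel P, (⨅ ω ∈ Ω, (M.valNMCB ω).1) ≤ (M.valNMCB β).1

/-! ### Hilbert calculi -/

namespace OuterForm

variable {P : Type u}

/-- `⊤ := τ → τ`. -/
def top (τ : OuterForm P) : OuterForm P := imp τ τ

/-- `⊥ := τ ⤙ τ`. -/
def bot (τ : OuterForm P) : OuterForm P := coimp τ τ

/-- `∼φ := φ → ⊥`, with `⊥` built from `τ`. -/
def sneg (τ φ : OuterForm P) : OuterForm P := imp φ (bot τ)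

/-- `φ ↔ χ`. -/
def iff (φ χ : OuterForm P) : OuterForm P := and (imp φ χ) (imp χ φ)

/-- Strong implication `(φ ⤏ χ) ∧ (¬χ ⤏ ¬φ)`. -/
def strongImp (φ χ : OuterForm P) : OuterForm P := and (imp φ χ) (imp (neg χ) (neg φ))

/-- Strong equivalence. -/
def strongIff (φ χ : OuterForm P) : OuterForm P := and (strongImp φ χ) (strongImp χ φ)

end OuterForm

open OuterForm in
/-- The axioms common to both outer-layer calculi, for outer-layer formulas: the axioms of
bi-intuitionistic logic, the two prelinearity axioms, and the laws for `¬¬`, `¬∧`, `¬∨`.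
`τ` is the formula from which `⊤` and `⊥` are built. -/
inductive CommonAx {P : Type u} : OuterForm P → Prop
  | trans (φ χ ψ) : CommonAx (imp (imp φ χ) (imp (imp χ ψ) (imp φ ψ)))
  | orL (φ χ) : CommonAx (imp φ (or φ χ))
  | orR (φ χ) : CommonAx (imp χ (or φ χ))
  | orE (φ χ ψ) : CommonAx (imp (imp φ ψ) (imp (imp χ ψ) (imp (or φ χ) ψ)))
  | andL (φ χ) : CommonAx (imp (and φ χ) φ)
  | andR (φ χ) : CommonAx (imp (and φ χ) χ)
  | andI (φ χ ψ) : CommonAx (imp (imp φ χ) (imp (imp φ ψ) (imp φ (and χ ψ))))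
  | uncurry (φ χ ψ) : CommonAx (imp (imp φ (imp χ ψ)) (imp (and φ χ) ψ))
  | curry (φ χ ψ) : CommonAx (imp (imp (and φ χ) ψ) (imp φ (imp χ ψ)))
  | contra (τ φ χ) : CommonAx (imp (imp φ χ) (imp (sneg τ χ) (sneg τ φ)))
  | coimpTop (τ φ χ) : CommonAx (imp (coimp φ χ) (coimp (top τ) (imp φ χ)))
  | snegCoimp (τ φ χ) : CommonAx (imp (sneg τ (coimp φ χ)) (imp φ χ))
  | coimpI (φ χ) : CommonAx (imp φ (or χ (coimp φ χ)))
  | coimpOr (φ χ ψ) : CommonAx (imp (coimp (coimp φ χ) ψ) (coimp φ (or χ ψ)))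
  | prel (φ χ) : CommonAx (or (imp φ χ) (imp χ φ))
  | coprel (τ φ χ) : CommonAx (sneg τ (and (coimp φ χ) (coimp χ φ)))
  | negNeg (φ) : CommonAx (iff (neg (neg φ)) φ)
  | negAnd (φ χ) : CommonAx (iff (neg (and φ χ)) (or (neg φ) (neg χ)))
  | negOr (φ χ) : CommonAx (iff (neg (or φ χ)) (and (neg φ) (neg χ)))

open OuterForm in
/-- Axioms of the Hilbert calculus for `MCB`. -/
inductive MCBAx {P : Type u} : LMCB P → Prop
  | common (α) : CommonAx α → MCBAx α
  | negImp (φ χ) : MCBAx (iff (neg (imp φ χ)) (coimp (neg χ) (neg φ)))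
  | negCoimp (φ χ) : MCBAx (iff (neg (coimp φ χ)) (imp (neg χ) (neg φ)))
  | bd (φ χ) : BDValid φ χ → MCBAx (imp (C φ) (C χ))
  | negC (φ) : MCBAx (iff (C (BDForm.neg φ)) (neg (C φ)))

open OuterForm in
/-- Axioms of the Hilbert calculus for `NMCB`. -/
inductive NMCBAx {P : Type u} : LNMCB P → Prop
  | common (α) : CommonAx α → NMCBAx α
  | negImp (φ χ) : NMCBAx (iff (neg (imp φ χ)) (and φ (neg χ)))
  | negCoimp (φ χ) : NMCBAx (iff (neg (coimp φ χ)) (or (neg φ) χ))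
  | bd (φ χ) : BDValid φ χ → NMCBAx (strongImp (C φ) (C χ))
  | negC (φ) : NMCBAx (strongIff (C (BDForm.neg φ)) (neg (C φ)))

open OuterForm in
/-- `Derives Ax Γ α`: `α` is derivable from `Γ` with the axioms `Ax`, modus ponens, and
necessitation `⊢ φ / ⊢ (⊤ ⤙ φ) → ⊥`, which applies to theorems only. -/
inductive Derives {P : Type u} (Ax : OuterForm P → Prop) :
    Set (OuterForm P) → OuterForm P → Prop
  | ax {Γ α} : Ax α → Derives Ax Γ α
  | hyp {Γ α} : α ∈ Γ → Derives Ax Γ α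
  | mp {Γ α β} : Derives Ax Γ α → Derives Ax Γ (imp α β) → Derives Ax Γ β
  | nec {Γ α} (τ) : Derives Ax ∅ α → Derives Ax Γ (imp (coimp (top τ) α) (bot τ))

/-- Derivability in the Hilbert calculus for `MCB`. -/
def MCBDerives {P : Type u} (Ψ : Set (LMCB P)) (α : LMCB P) : Prop := Derives MCBAx Ψ α

/-- Derivability in the Hilbert calculus for `NMCB`. -/
def NMCBDerives {P : Type u} (Ω : Set (LNMCB P)) (β : LNMCB P) : Prop := Derives NMCBAx Ω β

/-! ## Valuations of prelinear bi-Heyting algebras in the unit interval -/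

section Biheyting

variable {A : Type*} [BiheytingAlgebra A]

/-! Soundness is an induction over valuations in the standard Gödel algebra on `[0,1]`. For `MCB`
both `e₁` and `1 - e₂` are such valuations.

For completeness, formulas modulo provable equivalence form a countable prelinear and coprelinear
bi-Heyting algebra. Negation is not an operation on it: in `NMCB`, equivalence of two formulas does
not give equivalence of their negations. If `Γ` does not derive `α`, the class of `α` lies outside
the filter of consequences of `Γ`, and a prime ideal `J` contains the former and misses the latter.

The complement of `J` alone respects the Heyting structure but not co-implication. The remedy is
`￢￢`, which on a chain sends `⊤` to `⊤` and everything else to `⊥`. Coprelinearity makes it a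
lattice endomorphism below the identity, so `￢￢(x ⇨ y) ∉ J` is a total preorder whose quotient chain
carries all operations, and `J` is an initial segment of it. The countable chain is placed in
`[0,1]` with a gap at the edge of `J` (`exists_godelHom_of_isPrime`). The gap keeps the infimum over
an infinite `Γ` strictly above the value of `α`, so no compactness argument is needed.

The resulting valuation `e` comes from a belief model: the worlds are all four-valued valuations,
and a monotone measure extends `|φ|⁺ ↦ e (C φ)`. By the axioms for `¬`, `e₁ α = e α` and `e₂ α = e
(¬α)` there. -/

theorem hnot_sup_eq_of_coprelinear (hc : ∀ a b : A, (a \ b) ⊓ (b \ a) = ⊥) (a b : A) :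
    ￢(a ⊔ b) = ￢a ⊓ ￢b := by
  apply le_antisymm
  · exact le_inf (hnot_anti le_sup_left) (hnot_anti le_sup_right)
  · have h1 : ￢a ≤ ￢(a ⊔ b) ⊔ (b \ a) := by
      rw [← top_sdiff', sdiff_le_iff, sup_comm (￢(a ⊔ b)), ← sup_assoc, sup_sdiff_self_right]
      exact (sup_hnot_self _).ge
    have h2 : ￢b ≤ ￢(a ⊔ b) ⊔ (a \ b) := by
      rw [← top_sdiff', sdiff_le_iff, sup_comm (￢(a ⊔ b)), ← sup_assoc, sup_sdiff_self_right,
        sup_comm b a]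
      exact (sup_hnot_self _).ge
    calc ￢a ⊓ ￢b ≤ (￢(a ⊔ b) ⊔ (b \ a)) ⊓ (￢(a ⊔ b) ⊔ (a \ b)) := inf_le_inf h1 h2
      _ = ￢(a ⊔ b) := by rw [← sup_inf_left, hc, sup_bot_eq]

/-- The dual of Stone's law: the values of `￢` are complemented, so `￢￢` behaves as a two-valued
test for being `⊤`. -/
theorem hnot_inf_hnot_hnot_of_coprelinear (hc : ∀ a b : A, (a \ b) ⊓ (b \ a) = ⊥) (a : A) :
    ￢a ⊓ ￢￢a = ⊥ := by
  rw [← hnot_sup_eq_of_coprelinear hc, sup_hnot_self, hnot_top]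

theorem hnot_hnot_sup_of_coprelinear (hc : ∀ a b : A, (a \ b) ⊓ (b \ a) = ⊥) (a b : A) :
    ￢￢(a ⊔ b) = ￢￢a ⊔ ￢￢b := by
  rw [hnot_sup_eq_of_coprelinear hc, hnot_inf_distrib]

theorem hnot_hnot_inf_of_coprelinear (hc : ∀ a b : A, (a \ b) ⊓ (b \ a) = ⊥) (a b : A) :
    ￢￢(a ⊓ b) = ￢￢a ⊓ ￢￢b := by
  rw [hnot_inf_distrib, hnot_sup_eq_of_coprelinear hc]

/-- The algebraic form of the second clause of Gödel implication: where `a ≤ b` fails, `a ⇨ b`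
collapses to `b`. -/
theorem himp_sup_himp_himp_of_prelinear (hp : ∀ a b : A, (a ⇨ b) ⊔ (b ⇨ a) = ⊤) (a b : A) :
    (a ⇨ b) ⊔ ((a ⇨ b) ⇨ b) = ⊤ := by
  rw [eq_top_iff, ← hp a (a ⇨ b)]
  refine sup_le_sup (by simp) ?_
  rw [le_himp_iff]
  calc ((a ⇨ b) ⇨ a) ⊓ (a ⇨ b) ≤ a ⊓ (a ⇨ b) := le_inf himp_inf_le inf_le_right
    _ ≤ b := inf_himp_le

/-- By prelinearity one may split according to which of `b`, `c` is the larger. In either case the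
join collapses to that one. -/
theorem himp_sup_eq_of_prelinear (hp : ∀ a b : A, (a ⇨ b) ⊔ (b ⇨ a) = ⊤) (a b c : A) :
    a ⇨ (b ⊔ c) ≤ (a ⇨ b) ⊔ (a ⇨ c) := by
  have key : ∀ b c : A, (a ⇨ (b ⊔ c)) ⊓ (b ⇨ c) ≤ a ⇨ c := fun b c => by
    rw [le_himp_iff]
    calc (a ⇨ (b ⊔ c)) ⊓ (b ⇨ c) ⊓ a ≤ (b ⊔ c) ⊓ (b ⇨ c) := by
          refine le_inf ?_ (inf_le_left.trans inf_le_right)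
          exact (inf_le_inf_right a inf_le_left).trans himp_inf_le
      _ ≤ c := by
          rw [inf_sup_right]
          exact sup_le inf_himp_le inf_le_left
  calc a ⇨ (b ⊔ c) = (a ⇨ (b ⊔ c)) ⊓ ((b ⇨ c) ⊔ (c ⇨ b)) := by rw [hp, inf_top_eq]
    _ = (a ⇨ (b ⊔ c)) ⊓ (b ⇨ c) ⊔ (a ⇨ (c ⊔ b)) ⊓ (c ⇨ b) := by
        rw [inf_sup_left, sup_comm c b]
    _ ≤ (a ⇨ b) ⊔ (a ⇨ c) := sup_le ((key b c).trans le_sup_right) ((key c b).trans le_sup_left)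

/-- The counterpart for co-implication: where `a ≤ b` fails, `a \ b` collapses to `a`. It comes from
distributing `a ⇨ ·` over `a ≤ b ⊔ a \ b`. -/
theorem himp_sup_himp_sdiff_of_prelinear (hp : ∀ a b : A, (a ⇨ b) ⊔ (b ⇨ a) = ⊤) (a b : A) :
    (a ⇨ b) ⊔ (a ⇨ a \ b) = ⊤ := by
  rw [eq_top_iff]
  refine le_trans ?_ (himp_sup_eq_of_prelinear hp a b (a \ b))
  rw [top_le_iff, himp_eq_top_iff]
  exact le_sup_sdiff

theorem sdiff_le_hnot_himp (a b : A) : a \ b ≤ ￢(a ⇨ b) := by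
  rw [sdiff_le_iff]
  calc a = a ⊓ ((a ⇨ b) ⊔ ￢(a ⇨ b)) := by rw [sup_hnot_self, inf_top_eq]
    _ ≤ b ⊔ ￢(a ⇨ b) := by
        rw [inf_sup_left]
        exact sup_le_sup inf_himp_le inf_le_right

/-- The first clause of Gödel co-implication: if `a ≤ b` in the preorder of a prime ideal, then `a \
b` is equivalent to `⊥`. -/
theorem hnot_hnot_himp_le_of_coprelinear (hc : ∀ a b : A, (a \ b) ⊓ (b \ a) = ⊥) (a b : A) :
    ￢￢(a ⇨ b) ≤ ￢￢(a \ b ⇨ ⊥) := by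
  have h : ￢￢(a ⇨ b) ≤ a \ b ⇨ ⊥ := by
    rw [le_himp_iff]
    calc ￢￢(a ⇨ b) ⊓ (a \ b) ≤ ￢￢(a ⇨ b) ⊓ ￢(a ⇨ b) :=
          inf_le_inf_left _ (sdiff_le_hnot_himp a b)
      _ = ⊥ := by rw [inf_comm, hnot_inf_hnot_hnot_of_coprelinear hc]
      _ ≤ ⊥ := le_rfl
  have := hnot_anti (hnot_anti h)
  rwa [hnot_hnot_hnot] at this

end Biheyting

/-! ### Gödel homomorphisms from prime ideals -/

theorem exists_real_representation_of_total {A : Type*} [Countable A] (r : A → A → Prop)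
    (htrans : ∀ x y z, r x y → r y z → r x z) (htotal : ∀ x y, r x y ∨ r y x) :
    ∃ f : A → ℝ, (∀ x, 0 < f x ∧ f x < 1) ∧ ∀ x y, f x ≤ f y ↔ r x y := by
  classical
  let _ : Preorder A :=
    { le := r
      le_refl := fun x => (htotal x x).elim id id
      le_trans := htrans }
  have : Std.Total (α := A) (· ≤ ·) := ⟨htotal⟩
  have : Countable (Antisymmetrization A (· ≤ ·)) := Quotient.countable
  have : Nontrivial (Set.Ioo (0 : ℝ) 1) :=
    ⟨⟨1 / 2, by norm_num, by norm_num⟩, ⟨1 / 3, by norm_num, by norm_num⟩,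
      fun h => by have := congrArg Subtype.val h; norm_num at this⟩
  obtain ⟨g⟩ := Order.embedding_from_countable_to_dense
    (Antisymmetrization A (· ≤ ·)) (Set.Ioo (0 : ℝ) 1)
  refine ⟨fun x => g (toAntisymmetrization (· ≤ ·) x), fun x => (g _).2, fun x y => ?_⟩
  rw [Subtype.coe_le_coe, g.le_iff_le]
  exact toAntisymmetrization_le_toAntisymmetrization_iff

/-- A function into `[0,1]` that turns the bi-Heyting operations into the Gödel operations. -/
structure IsGodelHom {A : Type*} [BiheytingAlgebra A] (v : A → I) : Prop where
  inf : ∀ x y, v (x ⊓ y) = min (v x) (v y)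
  sup : ∀ x y, v (x ⊔ y) = max (v x) (v y)
  himp : ∀ x y, v (x ⇨ y) = gImp (v x) (v y)
  sdiff : ∀ x y, v (x \ y) = gCoimp (v x) (v y)

theorem IsGodelHom.monotone {A : Type*} [BiheytingAlgebra A] {v : A → I} (hv : IsGodelHom v) :
    Monotone v := fun x y h => by
  have := hv.inf x y
  rw [inf_eq_left.2 h] at this
  exact this ▸ min_le_right _ _

/-- The total preorder on a prelinear bi-Heyting algebra given by a prime ideal. -/
def primeLe {A : Type*} [BiheytingAlgebra A] (J : Order.Ideal A) (x y : A) : Prop :=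
  ￢￢(x ⇨ y) ∉ J

section PrimeLe

variable {A : Type*} [BiheytingAlgebra A] {J : Order.Ideal A}

/-- Since `￢￢` preserves joins and `⊤`, two failures would put `⊤` in `J`. This turns the identities
with value `⊤` into case distinctions in the preorder, totality among them. -/
theorem primeLe_of_sup (hJ : J.IsPrime) (hc : ∀ a b : A, (a \ b) ⊓ (b \ a) = ⊥) {x y z w : A}
    (h : (x ⇨ y) ⊔ (z ⇨ w) = ⊤) : primeLe J x y ∨ primeLe J z w := by
  by_contra! hn
  simp only [primeLe, not_not] at hn
  have := Order.Ideal.sup_mem hn.1 hn.2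
  rw [← hnot_hnot_sup_of_coprelinear hc, h, hnot_top, hnot_bot] at this
  exact hJ.toIsProper.top_notMem this

theorem primeLe_of_le (hJ : J.IsPrime) {x y : A} (h : x ≤ y) : primeLe J x y := by
  rw [primeLe, himp_eq_top_iff.2 h, hnot_top, hnot_bot]
  exact hJ.toIsProper.top_notMem

theorem primeLe_of_himp_le {x y z w : A} (h : primeLe J x y) (h' : x ⇨ y ≤ z ⇨ w) :
    primeLe J z w := fun hm => h (J.lower (hnot_anti (hnot_anti h')) hm)

theorem primeLe_trans (hJ : J.IsPrime) (hc : ∀ a b : A, (a \ b) ⊓ (b \ a) = ⊥) {x y z : A}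
    (h1 : primeLe J x y) (h2 : primeLe J y z) : primeLe J x z := by
  intro hm
  have : ￢￢(x ⇨ y) ⊓ ￢￢(y ⇨ z) ∈ J := by
    refine J.lower ?_ hm
    rw [← hnot_hnot_inf_of_coprelinear hc]
    refine hnot_anti (hnot_anti ?_)
    rw [le_himp_iff, inf_right_comm]
    exact (inf_le_inf_right _ himp_inf_le).trans inf_himp_le
  exact (hJ.mem_or_mem this).elim h1 h2

/-- Because `￢￢z ≤ z`, modus ponens survives and primality applies. So `J` is an initial segment of
the preorder, which is what lets a gap be opened at its edge. -/
theorem mem_of_primeLe (hJ : J.IsPrime) {x y : A} (h : primeLe J x y) (hy : y ∈ J) : x ∈ J := by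
  have : ￢￢(x ⇨ y) ⊓ x ∈ J :=
    J.lower ((inf_le_inf_right x hnot_hnot_le).trans himp_inf_le) hy
  exact (hJ.mem_or_mem this).resolve_left h

end PrimeLe

theorem exists_godelHom_of_isPrime {A : Type*} [BiheytingAlgebra A] [Countable A]
    (hp : ∀ a b : A, (a ⇨ b) ⊔ (b ⇨ a) = ⊤) (hc : ∀ a b : A, (a \ b) ⊓ (b \ a) = ⊥)
    {J : Order.Ideal A} (hJ : J.IsPrime) :
    ∃ v : A → I, IsGodelHom v ∧ ∀ a ∈ J, ∃ c, v a < c ∧ ∀ t ∉ J, c ≤ v t := by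
  classical
  have htot : ∀ x y, primeLe J x y ∨ primeLe J y x := fun x y => primeLe_of_sup hJ hc (hp x y)
  have htrans : ∀ x y z, primeLe J x y → primeLe J y z → primeLe J x z :=
    fun x y z => primeLe_trans hJ hc
  obtain ⟨f, hf, hfr⟩ := exists_real_representation_of_total (primeLe J) htrans htot
  have hbot : (⊥ : A) ∈ J := J.bot_mem
  have htop : (⊤ : A) ∉ J := hJ.toIsProper.top_notMem
  -- Values lie in `(0,1)` on `J` and in `(1,2)` off `J`. The order is unchanged because `J` is an
  -- initial segment.
  set g : A → ℝ := fun x => f x + if x ∈ J then 0 else 1 with hg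
  have hgJ : ∀ x ∈ J, g x = f x := fun x hx => by simp [hg, hx]
  have hgJ' : ∀ x ∉ J, g x = f x + 1 := fun x hx => by simp [hg, hx]
  have hgr : ∀ x y, g x ≤ g y ↔ primeLe J x y := by
    intro x y
    by_cases hx : x ∈ J <;> by_cases hy : y ∈ J
    · rw [hgJ x hx, hgJ y hy, hfr]
    · rw [hgJ x hx, hgJ' y hy]
      refine iff_of_true (by linarith [(hf x).2, (hf y).1]) ?_
      exact (htot x y).resolve_right fun h => hy (mem_of_primeLe hJ h hx)
    · rw [hgJ' x hx, hgJ y hy]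
      refine iff_of_false (by linarith [(hf x).1, (hf y).2]) ?_
      exact fun h => hx (mem_of_primeLe hJ h hy)
    · rw [hgJ' x hx, hgJ' y hy, add_le_add_iff_right, hfr]
  have hD : 0 < g ⊤ - g ⊥ := by
    rw [hgJ' _ htop, hgJ _ hbot]
    linarith [(hf ⊤).1, (hf ⊥).2]
  have hglo : ∀ x, g ⊥ ≤ g x := fun x => (hgr _ _).2 (primeLe_of_le hJ bot_le)
  have hghi : ∀ x, g x ≤ g ⊤ := fun x => (hgr _ _).2 (primeLe_of_le hJ le_top)
  -- Affine rescaling, so that `⊥` goes to `0` and `⊤` to `1`.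
  let v : A → I := fun x => ⟨(g x - g ⊥) / (g ⊤ - g ⊥),
    div_nonneg (sub_nonneg.2 (hglo x)) hD.le,
    (div_le_one hD).2 (sub_le_sub_right (hghi x) _)⟩
  have hv : ∀ x y, v x ≤ v y ↔ primeLe J x y := fun x y => by
    rw [← hgr, ← Subtype.coe_le_coe]
    change (g x - g ⊥) / (g ⊤ - g ⊥) ≤ (g y - g ⊥) / (g ⊤ - g ⊥) ↔ _
    rw [div_le_div_iff_of_pos_right hD, sub_le_sub_iff_right]
  have hve : ∀ x y, primeLe J x y → primeLe J y x → v x = v y :=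
    fun x y h1 h2 => le_antisymm ((hv _ _).2 h1) ((hv _ _).2 h2)
  have hvbot : v ⊥ = 0 := Subtype.ext (by simp [v])
  have hvtop : v ⊤ = 1 := Subtype.ext (by simp [v, div_self hD.ne'])
  have hle : ∀ {x y : A}, x ≤ y → primeLe J x y := primeLe_of_le hJ
  refine ⟨v, ⟨fun x y => ?_, fun x y => ?_, fun x y => ?_, fun x y => ?_⟩, fun a ha => ?_⟩
  · rcases htot x y with h | h
    · rw [min_eq_left ((hv _ _).2 h)]
      exact hve _ _ (hle inf_le_left) (primeLe_of_himp_le h (by simp))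
    · rw [min_eq_right ((hv _ _).2 h)]
      exact hve _ _ (hle inf_le_right) (primeLe_of_himp_le h (by simp))
  · rcases htot x y with h | h
    · rw [max_eq_right ((hv _ _).2 h)]
      exact hve _ _ (primeLe_of_himp_le h (by simp)) (hle le_sup_right)
    · rw [max_eq_left ((hv _ _).2 h)]
      exact hve _ _ (primeLe_of_himp_le h (by simp)) (hle le_sup_left)
  · unfold gImp
    split_ifs with h
    · rw [hv] at h
      rw [← hvtop]
      exact hve _ _ (hle le_top) (primeLe_of_himp_le h (by simp))
    · rw [hv] at h
      exact hve _ _ ((primeLe_of_sup hJ hc (himp_sup_himp_himp_of_prelinear hp x y)).resolve_left h)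
        (hle le_himp)
  · unfold gCoimp
    split_ifs with h
    · rw [hv] at h
      rw [← hvbot]
      exact hve _ _ (fun hm => h (J.lower (hnot_hnot_himp_le_of_coprelinear hc x y) hm))
        (hle bot_le)
    · rw [hv] at h
      exact hve _ _ (hle sdiff_le)
        ((primeLe_of_sup hJ hc (himp_sup_himp_sdiff_of_prelinear hp x y)).resolve_left h)
  · have h1 : 1 ≤ g ⊤ := by rw [hgJ' _ htop]; linarith [(hf ⊤).1]
    have h0 : g ⊥ ≤ 1 := by rw [hgJ _ hbot]; exact (hf ⊥).2.le
    -- The threshold `c` is the rescaled image of `1`, the point between the two ranges of `g`.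
    refine ⟨⟨(1 - g ⊥) / (g ⊤ - g ⊥), div_nonneg (sub_nonneg.2 h0) hD.le,
      (div_le_one hD).2 (sub_le_sub_right h1 _)⟩, ?_, fun t ht => ?_⟩
    · refine Subtype.coe_lt_coe.1 (div_lt_div_of_pos_right (sub_lt_sub_right ?_ _) hD)
      rw [hgJ a ha]
      exact (hf a).2
    · refine Subtype.coe_le_coe.1 (div_le_div_of_nonneg_right (sub_le_sub_right ?_ _) hD.le)
      rw [hgJ' t ht]
      linarith [(hf t).1]

/-- In a countable prelinear bi-Heyting algebra a filter is separated from an element outside of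
it, with a gap, by a homomorphism to the standard algebra on `[0,1]`. -/
theorem exists_godelHom_separating {A : Type*} [BiheytingAlgebra A] [Countable A]
    (hp : ∀ a b : A, (a ⇨ b) ⊔ (b ⇨ a) = ⊤) (hc : ∀ a b : A, (a \ b) ⊓ (b \ a) = ⊥)
    (F : Order.PFilter A) {a : A} (ha : a ∉ F) :
    ∃ v : A → I, IsGodelHom v ∧ ∃ c, v a < c ∧ ∀ t ∈ F, c ≤ v t := by
  have hdisj : Disjoint (F : Set A) (Order.Ideal.principal a : Set A) :=
    Set.disjoint_left.2 fun t ht hta => ha (F.mem_of_le hta ht)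
  obtain ⟨J, hJ, hIJ, hFJ⟩ := DistribLattice.prime_ideal_of_disjoint_filter_ideal hdisj
  obtain ⟨v, hv, h⟩ := exists_godelHom_of_isPrime hp hc hJ
  obtain ⟨c, hc1, hc2⟩ := h a (hIJ (Order.Ideal.mem_principal_self))
  exact ⟨v, hv, c, hc1, fun t ht => hc2 t fun htJ => Set.disjoint_left.1 hFJ ht htJ⟩

/-! ## The Lindenbaum algebra of an outer-layer calculus -/

section Hilbert

open OuterForm

variable {P : Type u}

/-- The axiom set `Ax` contains the axioms shared by the two outer-layer calculi. -/
class ExtendsCommonAx (Ax : OuterForm P → Prop) : Prop where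
  of_commonAx : ∀ {α}, CommonAx α → Ax α

variable {Ax : OuterForm P → Prop} {Γ : Set (OuterForm P)} {α β γ : OuterForm P}

theorem Derives.weaken (h : Derives Ax ∅ α) : Derives Ax Γ α := by
  generalize hΔ : (∅ : Set (OuterForm P)) = Δ at h
  induction h with
  | ax h => exact .ax h
  | hyp h => subst hΔ; exact absurd h (Set.notMem_empty _)
  | mp _ _ ih1 ih2 => exact .mp (ih1 hΔ) (ih2 hΔ)
  | nec τ h => exact .nec τ h

namespace Derives

variable [ExtendsCommonAx Ax]

theorem common (h : CommonAx α) : Derives Ax Γ α := .ax (ExtendsCommonAx.of_commonAx h)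

theorem imp_trans (h1 : Derives Ax Γ (imp α β)) (h2 : Derives Ax Γ (imp β γ)) :
    Derives Ax Γ (imp α γ) := .mp h2 (.mp h1 (common (.trans _ _ _)))

theorem imp_const (h : Derives Ax Γ α) : Derives Ax Γ (imp β α) :=
  .mp h (.mp (common (.andL α β)) (common (.curry α β α)))

variable (Ax Γ) in
theorem imp_refl (α : OuterForm P) : Derives Ax Γ (imp α α) :=
  -- `X ∧ α → α` curries to `X → (α → α)`, and `(α ∧ α) → α` serves as the theorem `X`.
  .mp (common (.andL α α)) (.mp (common (.andR (imp (and α α) α) α)) (common (.curry _ _ _)))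

theorem imp_and (h1 : Derives Ax Γ (imp α β)) (h2 : Derives Ax Γ (imp α γ)) :
    Derives Ax Γ (imp α (and β γ)) := .mp h2 (.mp h1 (common (.andI _ _ _)))

theorem or_imp (h1 : Derives Ax Γ (imp α γ)) (h2 : Derives Ax Γ (imp β γ)) :
    Derives Ax Γ (imp (or α β) γ) := .mp h2 (.mp h1 (common (.orE _ _ _)))

theorem and_intro (h1 : Derives Ax Γ α) (h2 : Derives Ax Γ β) : Derives Ax Γ (and α β) :=
  .mp h1 (imp_and (imp_refl Ax Γ α) (imp_const h2))

theorem and_left (h : Derives Ax Γ (and α β)) : Derives Ax Γ α := .mp h (common (.andL _ _))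

theorem and_right (h : Derives Ax Γ (and α β)) : Derives Ax Γ β := .mp h (common (.andR _ _))

theorem imp_imp_iff : Derives Ax Γ (imp α (imp β γ)) ↔ Derives Ax Γ (imp (and α β) γ) :=
  ⟨fun h => .mp h (common (.uncurry _ _ _)), fun h => .mp h (common (.curry _ _ _))⟩

theorem sneg_coimp_of_imp (τ : OuterForm P) (h : Derives Ax ∅ (imp α β)) :
    Derives Ax ∅ (sneg τ (coimp α β)) :=
  .mp (.nec τ h) (.mp (common (.coimpTop τ α β)) (common (.contra τ _ _)))

/-- Co-residuation. From right to left, necessitation refutes `α ⤙ (β ∨ γ)`, hence by contraposition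
`(α ⤙ β) ⤙ γ`, and a refuted co-implication yields the implication. The use of necessitation is why
there are no hypotheses on either side. -/
theorem coimp_imp_iff :
    Derives Ax ∅ (imp (coimp α β) γ) ↔ Derives Ax ∅ (imp α (or β γ)) := by
  constructor
  · intro h
    exact imp_trans (common (.coimpI α β))
      (or_imp (common (.orL _ _)) (imp_trans h (common (.orR _ _))))
  · intro h
    refine .mp ?_ (common (.snegCoimp α (coimp α β) γ))
    exact .mp (sneg_coimp_of_imp α h) (.mp (common (.coimpOr α β γ)) (common (.contra α _ _)))

theorem coimp_self_imp (τ α : OuterForm P) : Derives Ax ∅ (imp (bot τ) α) :=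
  coimp_imp_iff.2 (common (.orL τ α))

end Derives

variable (Ax) [ExtendsCommonAx Ax]

/-- Provable equivalence. -/
def provEquiv : Setoid (OuterForm P) where
  r α β := Derives Ax ∅ (imp α β) ∧ Derives Ax ∅ (imp β α)
  iseqv :=
    { refl := fun α => ⟨.imp_refl _ _ α, .imp_refl _ _ α⟩
      symm := fun h => ⟨h.2, h.1⟩
      trans := fun h1 h2 => ⟨h1.1.imp_trans h2.1, h2.2.imp_trans h1.2⟩ }

/-- Formulas modulo provable equivalence. -/
def Lindenbaum : Type u := Quotient (provEquiv Ax)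

namespace Lindenbaum

/-- The class of a formula. -/
def mk (α : OuterForm P) : Lindenbaum Ax := Quotient.mk (provEquiv Ax) α

variable {Ax}

theorem ind {p : Lindenbaum Ax → Prop} (h : ∀ α, p (mk Ax α)) (x : Lindenbaum Ax) : p x :=
  Quotient.ind h x

theorem mk_eq_mk : mk Ax α = mk Ax β ↔ Derives Ax ∅ (imp α β) ∧ Derives Ax ∅ (imp β α) :=
  Quotient.eq (r := provEquiv Ax)

instance : PartialOrder (Lindenbaum Ax) where
  le := Quotient.lift₂ (fun α β => Derives Ax ∅ (imp α β)) fun _ _ _ _ h1 h2 =>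
    propext ⟨fun h => (h1.2.imp_trans h).imp_trans h2.1, fun h => (h1.1.imp_trans h).imp_trans h2.2⟩
  le_refl := ind fun α => .imp_refl _ _ α
  le_trans := ind fun _ => ind fun _ => ind fun _ => .imp_trans
  le_antisymm := ind fun _ => ind fun _ => fun h1 h2 => mk_eq_mk.2 ⟨h1, h2⟩

theorem mk_le_mk : mk Ax α ≤ mk Ax β ↔ Derives Ax ∅ (imp α β) := Iff.rfl

instance : Lattice (Lindenbaum Ax) where
  inf := Quotient.map₂ and fun _ _ h1 _ _ h2 =>
    ⟨.imp_and ((Derives.common (.andL _ _)).imp_trans h1.1)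
        ((Derives.common (.andR _ _)).imp_trans h2.1),
      .imp_and ((Derives.common (.andL _ _)).imp_trans h1.2)
        ((Derives.common (.andR _ _)).imp_trans h2.2)⟩
  sup := Quotient.map₂ or fun _ _ h1 _ _ h2 =>
    ⟨.or_imp (h1.1.imp_trans (.common (.orL _ _))) (h2.1.imp_trans (.common (.orR _ _))),
      .or_imp (h1.2.imp_trans (.common (.orL _ _))) (h2.2.imp_trans (.common (.orR _ _)))⟩
  inf_le_left := ind fun _ => ind fun _ => .common (.andL _ _)
  inf_le_right := ind fun _ => ind fun _ => .common (.andR _ _)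
  le_inf := ind fun _ => ind fun _ => ind fun _ => .imp_and
  le_sup_left := ind fun _ => ind fun _ => .common (.orL _ _)
  le_sup_right := ind fun _ => ind fun _ => .common (.orR _ _)
  sup_le := ind fun _ => ind fun _ => ind fun _ => .or_imp

theorem mk_and (α β : OuterForm P) : mk Ax (and α β) = mk Ax α ⊓ mk Ax β := rfl

theorem mk_or (α β : OuterForm P) : mk Ax (or α β) = mk Ax α ⊔ mk Ax β := rfl

theorem le_mk_imp_iff : mk Ax α ≤ mk Ax (imp β γ) ↔ mk Ax α ⊓ mk Ax β ≤ mk Ax γ :=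
  Derives.imp_imp_iff

theorem mk_coimp_le_iff : mk Ax (coimp α β) ≤ mk Ax γ ↔ mk Ax α ≤ mk Ax β ⊔ mk Ax γ :=
  Derives.coimp_imp_iff

theorem mk_imp_mono {α' β' : OuterForm P} (h1 : mk Ax α' ≤ mk Ax α) (h2 : mk Ax β ≤ mk Ax β') :
    mk Ax (imp α β) ≤ mk Ax (imp α' β') :=
  le_mk_imp_iff.2 (((inf_le_inf_left _ h1).trans (le_mk_imp_iff.1 le_rfl)).trans h2)

theorem mk_coimp_mono {α' β' : OuterForm P} (h1 : mk Ax α ≤ mk Ax α') (h2 : mk Ax β' ≤ mk Ax β) :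
    mk Ax (coimp α β) ≤ mk Ax (coimp α' β') :=
  mk_coimp_le_iff.2 ((h1.trans (mk_coimp_le_iff.1 le_rfl)).trans (sup_le_sup_right h2 _))

theorem imp_congr ⦃α α' : OuterForm P⦄ (h1 : (provEquiv Ax).r α α') ⦃β β' : OuterForm P⦄
    (h2 : (provEquiv Ax).r β β') : (provEquiv Ax).r (imp α β) (imp α' β') :=
  ⟨mk_imp_mono (Ax := Ax) h1.2 h2.1, mk_imp_mono (Ax := Ax) h1.1 h2.2⟩

theorem coimp_congr ⦃α α' : OuterForm P⦄ (h1 : (provEquiv Ax).r α α') ⦃β β' : OuterForm P⦄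
    (h2 : (provEquiv Ax).r β β') : (provEquiv Ax).r (coimp α β) (coimp α' β') :=
  ⟨mk_coimp_mono (Ax := Ax) h1.1 h2.2, mk_coimp_mono (Ax := Ax) h1.2 h2.1⟩

section Nonempty

variable [Nonempty P]

variable (P) in
/-- A formula to build the constants from. -/
noncomputable def baseForm : OuterForm P := C (.var (Classical.arbitrary P))

noncomputable instance : BiheytingAlgebra (Lindenbaum Ax) where
  top := mk Ax (top (baseForm P))
  bot := mk Ax (bot (baseForm P))
  le_top := ind fun _ => .imp_const (.imp_refl _ _ _)
  bot_le := ind fun _ => .coimp_self_imp _ _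
  himp := Quotient.map₂ imp imp_congr
  sdiff := Quotient.map₂ coimp coimp_congr
  compl x := Quotient.map₂ imp imp_congr x (mk Ax (bot (baseForm P)))
  hnot x := Quotient.map₂ coimp coimp_congr (mk Ax (top (baseForm P))) x
  le_himp_iff := ind fun _ => ind fun _ => ind fun _ => le_mk_imp_iff
  sdiff_le_iff := ind fun _ => ind fun _ => ind fun _ => mk_coimp_le_iff
  himp_bot _ := rfl
  top_sdiff _ := rfl

theorem mk_imp (α β : OuterForm P) : mk Ax (imp α β) = mk Ax α ⇨ mk Ax β := rfl

theorem mk_coimp (α β : OuterForm P) : mk Ax (coimp α β) = mk Ax α \ mk Ax β := rfl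

theorem mk_eq_top_iff : mk Ax α = ⊤ ↔ Derives Ax ∅ α := by
  rw [eq_top_iff]
  exact ⟨fun h => .mp (.imp_refl _ _ _) (mk_le_mk.1 h), fun h => mk_le_mk.2 h.imp_const⟩

theorem mk_bot (τ : OuterForm P) : mk Ax (bot τ) = ⊥ := by
  rw [bot, mk_coimp, sdiff_self]

theorem prelinear (x y : Lindenbaum Ax) : (x ⇨ y) ⊔ (y ⇨ x) = ⊤ := by
  induction x using ind with | _ α
  induction y using ind with | _ β
  exact mk_eq_top_iff.2 (.common (.prel α β))

theorem coprelinear (x y : Lindenbaum Ax) : (x \ y) ⊓ (y \ x) = ⊥ := by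
  induction x using ind with | _ α
  induction y using ind with | _ β
  have h : mk Ax (sneg α (and (coimp α β) (coimp β α))) = ⊤ :=
    mk_eq_top_iff.2 (.common (.coprel α α β))
  rwa [sneg, mk_imp, mk_bot, himp_eq_top_iff, le_bot_iff] at h

end Nonempty

/-- The filter of the classes of the formulas derivable from `Γ`. -/
def theoryFilter (Γ : Set (OuterForm P)) [Nonempty P] : Order.PFilter (Lindenbaum Ax) :=
  Order.IsPFilter.toPFilter (F := {x | ∃ α, mk Ax α = x ∧ Derives Ax Γ α}) <| by
    refine Order.IsPFilter.of_def ⟨_, top (baseForm P), rfl, .imp_refl _ _ _⟩ ?_ ?_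
    · rintro _ ⟨α, rfl, hα⟩ _ ⟨β, rfl, hβ⟩
      exact ⟨mk Ax (and α β), ⟨_, rfl, .and_intro hα hβ⟩, mk_le_mk.2 (.common (.andL _ _)),
        mk_le_mk.2 (.common (.andR _ _))⟩
    · rintro x y hxy ⟨α, rfl, hα⟩
      induction y using ind with | _ β
      exact ⟨β, rfl, .mp hα (mk_le_mk.1 hxy).weaken⟩

theorem mk_mem_theoryFilter [Nonempty P] : mk Ax α ∈ theoryFilter (Ax := Ax) Γ ↔ Derives Ax Γ α := by
  constructor
  · rintro ⟨β, hβ, h⟩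
    exact .mp h (mk_eq_mk.1 hβ).1.weaken
  · exact fun h => ⟨α, rfl, h⟩

end Lindenbaum

end Hilbert

/-! ## Soundness -/

section Soundness

open OuterForm

variable {P : Type u}

theorem gImp_eq_one_iff {a b : I} : gImp a b = 1 ↔ a ≤ b := by
  unfold gImp
  split_ifs with h
  · simp [h]
  · exact iff_of_false (fun hb => h (hb ▸ unitInterval.le_one')) h

theorem symm_gImp (a b : I) : σ (gImp a b) = gCoimp (σ b) (σ a) := by
  unfold gImp gCoimp
  simp only [unitInterval.symm_le_symm]
  split_ifs <;> simp

theorem symm_gCoimp (a b : I) : σ (gCoimp a b) = gImp (σ b) (σ a) := by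
  unfold gImp gCoimp
  simp only [unitInterval.symm_le_symm]
  split_ifs <;> simp

/-- Valuations of outer-layer formulas that read the connectives as the Gödel operations and
satisfy the De Morgan laws for `¬`. -/
structure IsGodelVal (e : OuterForm P → I) : Prop where
  and : ∀ α β, e (and α β) = min (e α) (e β)
  or : ∀ α β, e (or α β) = max (e α) (e β)
  imp : ∀ α β, e (imp α β) = gImp (e α) (e β)
  coimp : ∀ α β, e (coimp α β) = gCoimp (e α) (e β)
  negNeg : ∀ α, e (neg (neg α)) = e α
  negAnd : ∀ α β, e (neg (.and α β)) = max (e (neg α)) (e (neg β))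
  negOr : ∀ α β, e (neg (.or α β)) = min (e (neg α)) (e (neg β))

namespace IsGodelVal

variable {e : OuterForm P → I}

theorem imp_eq_one_iff (he : IsGodelVal e) {α β : OuterForm P} : e (.imp α β) = 1 ↔ e α ≤ e β := by
  rw [he.imp, gImp_eq_one_iff]

theorem bot (he : IsGodelVal e) (τ : OuterForm P) : e (OuterForm.bot τ) = 0 := by
  rw [OuterForm.bot, he.coimp, gCoimp, if_pos le_rfl]

theorem top (he : IsGodelVal e) (τ : OuterForm P) : e (OuterForm.top τ) = 1 := by
  rw [OuterForm.top, he.imp_eq_one_iff]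

theorem iff_eq_one (he : IsGodelVal e) {α β : OuterForm P} (h : e α = e β) : e (OuterForm.iff α β) = 1 := by
  rw [OuterForm.iff, he.and, he.imp_eq_one_iff.2 h.le, he.imp_eq_one_iff.2 h.ge, min_self]

theorem commonAx (he : IsGodelVal e) {α : OuterForm P} (h : CommonAx α) : e α = 1 := by
  cases h with
  | negNeg φ => exact he.iff_eq_one (he.negNeg φ)
  | negAnd φ χ => exact he.iff_eq_one (by rw [he.negAnd, he.or])
  | negOr φ χ => exact he.iff_eq_one (by rw [he.negOr, he.and])
  | prel φ χ =>
    rw [he.or, he.imp, he.imp]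
    rcases le_total (e φ) (e χ) with h | h <;> simp [gImp, h, unitInterval.le_one']
  | coprel τ φ χ =>
    rw [sneg, he.imp_eq_one_iff, he.and, he.coimp, he.coimp, he.bot]
    rcases le_total (e φ) (e χ) with h | h <;> simp [gCoimp, h]
  | _ =>
    simp only [sneg, he.imp, he.and, he.or, he.coimp, he.bot, he.top]
    -- The remaining axioms are now piecewise order statements about a few points of `[0,1]`,
    -- settled by splitting on comparisons.
    simp only [gImp, gCoimp]
    have h0 : ∀ a : I, 0 ≤ a := fun _ => unitInterval.nonneg'
    have h1 : ∀ a : I, a ≤ 1 := fun _ => unitInterval.le_one'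
    grind

theorem le_of_derives (he : IsGodelVal e) {Ax : OuterForm P → Prop} (hAx : ∀ α, Ax α → e α = 1)
    {Γ : Set (OuterForm P)} {α : OuterForm P} (h : Derives Ax Γ α) {c : I}
    (hc : ∀ γ ∈ Γ, c ≤ e γ) : c ≤ e α := by
  induction h generalizing c with
  | ax h => exact hAx _ h ▸ unitInterval.le_one'
  | hyp h => exact hc _ h
  | @mp Γ α β _ _ ih1 ih2 =>
    have h1 := ih1 hc
    have h2 := ih2 hc
    rw [he.imp, gImp] at h2
    split_ifs at h2 with h
    · exact h1.trans h
    · exact h2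
  | @nec Γ α τ _ ih =>
    -- The premise has no hypotheses, so the induction hypothesis is available with bound `1`.
    have h1 : e α = 1 := le_antisymm unitInterval.le_one' (ih fun _ h => h.elim)
    rw [he.imp_eq_one_iff.2]
    · exact unitInterval.le_one'
    · rw [he.coimp, he.top, he.bot, h1, gCoimp, if_pos le_rfl]

end IsGodelVal

theorem BDValid.posExt_subset {φ χ : BDForm P} (h : BDValid φ χ) (M : BDModel P) :
    M.posExt φ ⊆ M.posExt χ := fun w => (h M w).1

theorem BDValid.negExt_subset {φ χ : BDForm P} (h : BDValid φ χ) (M : BDModel P) :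
    M.negExt χ ⊆ M.negExt φ := fun w => (h M w).2

namespace BeliefModel

variable (M : BeliefModel P)

theorem isGodelVal_valMCB_fst : IsGodelVal fun α => (M.valMCB α).1 :=
  ⟨fun _ _ => rfl, fun _ _ => rfl, fun _ _ => rfl, fun _ _ => rfl, fun _ => rfl, fun _ _ => rfl,
    fun _ _ => rfl⟩

/-- The order reversal `σ` swaps `min` with `max` and Gödel implication with co-implication, so it
turns the `e₂` clauses of `MCB` into `e₁` clauses. One soundness argument then covers both halves of
the entailment. -/
theorem isGodelVal_symm_valMCB_snd : IsGodelVal fun α => σ (M.valMCB α).2 where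
  and _ _ := unitInterval.strictAnti_symm.antitone.map_max
  or _ _ := unitInterval.strictAnti_symm.antitone.map_min
  imp _ _ := symm_gCoimp _ _
  coimp _ _ := symm_gImp _ _
  negNeg _ := rfl
  negAnd _ _ := unitInterval.strictAnti_symm.antitone.map_min
  negOr _ _ := unitInterval.strictAnti_symm.antitone.map_max

theorem isGodelVal_valNMCB_fst : IsGodelVal fun α => (M.valNMCB α).1 :=
  ⟨fun _ _ => rfl, fun _ _ => rfl, fun _ _ => rfl, fun _ _ => rfl, fun _ => rfl, fun _ _ => rfl,
    fun _ _ => rfl⟩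

theorem valMCB_fst_eq_one {α : LMCB P} (h : MCBAx α) : (M.valMCB α).1 = 1 := by
  have he := M.isGodelVal_valMCB_fst
  cases h with
  | common α h => exact he.commonAx h
  | negImp φ χ => exact he.iff_eq_one rfl
  | negCoimp φ χ => exact he.iff_eq_one rfl
  | bd φ χ h => exact he.imp_eq_one_iff.2 (M.mono _ _ (h.posExt_subset _))
  | negC φ => exact he.iff_eq_one rfl

theorem symm_valMCB_snd_eq_one {α : LMCB P} (h : MCBAx α) : σ (M.valMCB α).2 = 1 := by
  have he := M.isGodelVal_symm_valMCB_snd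
  cases h with
  | common α h => exact he.commonAx h
  | negImp φ χ => exact he.iff_eq_one rfl
  | negCoimp φ χ => exact he.iff_eq_one rfl
  | bd φ χ h =>
    exact he.imp_eq_one_iff.2 (unitInterval.symm_le_symm.2 (M.mono _ _ (h.negExt_subset _)))
  | negC φ => exact he.iff_eq_one rfl

theorem valNMCB_fst_eq_one {α : LNMCB P} (h : NMCBAx α) : (M.valNMCB α).1 = 1 := by
  have he := M.isGodelVal_valNMCB_fst
  have hs : ∀ {α β : LNMCB P}, (M.valNMCB α).1 ≤ (M.valNMCB β).1 →
      (M.valNMCB β).2 ≤ (M.valNMCB α).2 → (M.valNMCB (strongImp α β)).1 = 1 := fun {α β} h1 h2 => by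
    refine (he.and _ _).trans ?_
    have h2' : (M.valNMCB (imp (neg β) (neg α))).1 = 1 := he.imp_eq_one_iff.2 h2
    rw [he.imp_eq_one_iff.2 h1, h2', min_self]
  cases h with
  | common α h => exact he.commonAx h
  | negImp φ χ => exact he.iff_eq_one rfl
  | negCoimp φ χ => exact he.iff_eq_one rfl
  | bd φ χ h =>
    exact hs (M.mono _ _ (h.posExt_subset _)) (M.mono _ _ (h.negExt_subset _))
  | negC φ =>
    refine (he.and _ _).trans ?_
    rw [hs, hs, min_self] <;> exact le_rfl

end BeliefModel

theorem MCBDerives.entails {Ψ : Set (LMCB P)} {α : LMCB P} (h : MCBDerives Ψ α) :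
    MCBEntails Ψ α := fun M => by
  constructor
  · exact M.isGodelVal_valMCB_fst.le_of_derives (fun _ => M.valMCB_fst_eq_one) h
      fun _ hγ => iInf₂_le _ hγ
  · refine unitInterval.symm_le_symm.1 ?_
    exact M.isGodelVal_symm_valMCB_snd.le_of_derives (fun _ => M.symm_valMCB_snd_eq_one) h
      fun γ hγ => unitInterval.symm_le_symm.2 (le_iSup₂ (f := fun ψ _ => (M.valMCB ψ).2) γ hγ)

theorem NMCBDerives.entails {Ω : Set (LNMCB P)} {β : LNMCB P} (h : NMCBDerives Ω β) :
    NMCBEntails Ω β := fun M =>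
  M.isGodelVal_valNMCB_fst.le_of_derives (fun _ => M.valNMCB_fst_eq_one) h
    fun _ hγ => iInf₂_le _ hγ

end Soundness

/-! ## Countability of the languages -/

section Countability

variable {P : Type u}

/-- An encoding of inner-layer formulas by natural numbers. -/
def BDForm.code (f : P → ℕ) : BDForm P → ℕ
  | .var p => Nat.pair 0 (f p)
  | .neg φ => Nat.pair 1 (φ.code f)
  | .and φ ψ => Nat.pair 2 (Nat.pair (φ.code f) (ψ.code f))
  | .or φ ψ => Nat.pair 3 (Nat.pair (φ.code f) (ψ.code f))

theorem BDForm.code_injective {f : P → ℕ} (hf : f.Injective) : (BDForm.code f).Injective := by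
  intro φ
  induction φ with
  | var p => intro χ h; cases χ <;> simp [BDForm.code, Nat.pair_eq_pair, hf.eq_iff] at h; rw [h]
  | neg φ ih => intro χ h; cases χ <;> simp [BDForm.code, Nat.pair_eq_pair] at h; rw [ih h]
  | and φ ψ ih1 ih2 =>
    intro χ h; cases χ <;> simp [BDForm.code, Nat.pair_eq_pair] at h; rw [ih1 h.1, ih2 h.2]
  | or φ ψ ih1 ih2 =>
    intro χ h; cases χ <;> simp [BDForm.code, Nat.pair_eq_pair] at h; rw [ih1 h.1, ih2 h.2]

instance [Countable P] : Countable (BDForm P) :=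
  let ⟨_, hf⟩ := exists_injective_nat P
  (BDForm.code_injective hf).countable

/-- An encoding of outer-layer formulas by natural numbers. -/
def OuterForm.code (f : BDForm P → ℕ) : OuterForm P → ℕ
  | .C φ => Nat.pair 0 (f φ)
  | .neg α => Nat.pair 1 (α.code f)
  | .and α β => Nat.pair 2 (Nat.pair (α.code f) (β.code f))
  | .or α β => Nat.pair 3 (Nat.pair (α.code f) (β.code f))
  | .imp α β => Nat.pair 4 (Nat.pair (α.code f) (β.code f))
  | .coimp α β => Nat.pair 5 (Nat.pair (α.code f) (β.code f))

theorem OuterForm.code_injective {f : BDForm P → ℕ} (hf : f.Injective) :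
    (OuterForm.code f).Injective := by
  intro α
  induction α with
  | C φ => intro χ h; cases χ <;> simp [OuterForm.code, Nat.pair_eq_pair, hf.eq_iff] at h; rw [h]
  | neg φ ih => intro χ h; cases χ <;> simp [OuterForm.code, Nat.pair_eq_pair] at h; rw [ih h]
  | _ φ ψ ih1 ih2 =>
    intro χ h; cases χ <;> simp [OuterForm.code, Nat.pair_eq_pair] at h; rw [ih1 h.1, ih2 h.2]

instance [Countable P] : Countable (OuterForm P) :=
  let ⟨_, hf⟩ := exists_injective_nat (BDForm P)
  (OuterForm.code_injective hf).countable

end Countability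

/-! ## The canonical model -/

section Canonical

variable {P : Type u}

/-- The Belnap–Dunn model whose worlds are all four-valued valuations. -/
def canonicalBD (P : Type u) : BDModel P where
  W := Set P × Set P
  nonempty := inferInstance
  vpos p := {w | p ∈ w.1}
  vneg p := {w | p ∈ w.2}

/-- Support at a world depends only on which variables it supports positively and negatively, so the
canonical worlds exhaust all behaviours. -/
theorem support_canonicalBD (M : BDModel P) (w : M.W) (φ : BDForm P) :
    (canonicalBD P).support ({p | w ∈ M.vpos p}, {p | w ∈ M.vneg p}) φ = M.support w φ := by
  induction φ with
  | var p => rfl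
  | neg φ ih => simp only [BDModel.support, ih]
  | and φ ψ ih1 ih2 => simp only [BDModel.support, ih1, ih2]
  | or φ ψ ih1 ih2 => simp only [BDModel.support, ih1, ih2]

/-- The duality `(s, t) ↦ (tᶜ, sᶜ)` exchanges positive support with absence of negative support.
Through it, inclusion of positive extensions already forces the reverse inclusion of negative ones.
-/
theorem support_canonicalBD_compl (s t : Set P) (φ : BDForm P) :
    (canonicalBD P).support (tᶜ, sᶜ) φ =
      (¬((canonicalBD P).support (s, t) φ).2, ¬((canonicalBD P).support (s, t) φ).1) := by
  induction φ with
  | var p => rfl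
  | neg φ ih => simp only [BDModel.support, ih]
  | and φ ψ ih1 ih2 => simp only [BDModel.support, ih1, ih2, not_or, not_and_or]
  | or φ ψ ih1 ih2 => simp only [BDModel.support, ih1, ih2, not_or, not_and_or]

theorem bdValid_of_canonicalBD {φ χ : BDForm P}
    (h : (canonicalBD P).posExt φ ⊆ (canonicalBD P).posExt χ) : BDValid φ χ := by
  have hpos : ∀ w, ((canonicalBD P).support w φ).1 → ((canonicalBD P).support w χ).1 :=
    fun w hw => h hw
  intro M w
  have hw := support_canonicalBD M w
  refine ⟨fun h1 => ?_, fun h1 => ?_⟩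
  · have := hpos ({p | w ∈ M.vpos p}, {p | w ∈ M.vneg p})
    rw [hw, hw] at this
    exact this h1
  · have := hpos ({p | w ∈ M.vneg p}ᶜ, {p | w ∈ M.vpos p}ᶜ)
    rw [support_canonicalBD_compl, support_canonicalBD_compl, hw, hw] at this
    exact not_imp_not.1 this h1

/-- This world supports every formula both ways, and its dual `(∅, ∅)` supports none. Hence no
positive extension is empty or full, which leaves the measure of `∅` and of the whole space free. -/
theorem support_canonicalBD_univ (φ : BDForm P) :
    ((canonicalBD P).support (Set.univ, Set.univ) φ).1 ∧
      ((canonicalBD P).support (Set.univ, Set.univ) φ).2 := by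
  induction φ with
  | var p => exact ⟨trivial, trivial⟩
  | neg φ ih => exact ih.symm
  | and φ ψ ih1 ih2 => exact ⟨⟨ih1.1, ih2.1⟩, .inl ih1.2⟩
  | or φ ψ ih1 ih2 => exact ⟨.inl ih1.1, ih1.2, ih2.2⟩

theorem posExt_canonicalBD_nonempty (φ : BDForm P) : ((canonicalBD P).posExt φ).Nonempty :=
  ⟨_, (support_canonicalBD_univ φ).1⟩

theorem posExt_canonicalBD_ne_univ (φ : BDForm P) : (canonicalBD P).posExt φ ≠ Set.univ := by
  intro h
  have h1 : (∅, ∅) ∈ (canonicalBD P).posExt φ := h ▸ Set.mem_univ _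
  have h2 := support_canonicalBD_compl (Set.univ : Set P) Set.univ φ
  rw [Set.compl_univ] at h2
  change ((canonicalBD P).support (∅, ∅) φ).1 at h1
  rw [h2] at h1
  exact h1 (support_canonicalBD_univ φ).2

open Classical in
/-- The canonical Belnap–Dunn model with the least uncertainty measure of total mass `1` that
dominates `m φ` on the positive extension of `φ`. -/
noncomputable def canonicalModel (m : BDForm P → I) : BeliefModel P where
  toBDModel := canonicalBD P
  -- Setting the full space to `1` disturbs no `m φ`, as it is not a positive extension. The empty
  -- set contains none, so it gets the empty supremum `0`.
  π X := if X = Set.univ then 1 else ⨆ φ, ⨆ (_ : (canonicalBD P).posExt φ ⊆ X), m φ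
  mono X Y h := by
    by_cases hY : Y = Set.univ
    · rw [if_pos hY]
      exact unitInterval.le_one'
    · have hX : X ≠ Set.univ := fun hX => hY (Set.univ_subset_iff.1 (hX ▸ h))
      rw [if_neg hX, if_neg hY]
      exact iSup_mono fun φ => iSup_mono' fun hφ => ⟨hφ.trans h, le_rfl⟩
  nontriv := by
    have : Nonempty (canonicalBD P).W := (canonicalBD P).nonempty
    rw [if_pos rfl, if_neg Set.empty_ne_univ]
    have h : ∀ φ, ¬(canonicalBD P).posExt φ ⊆ ∅ := fun φ hφ =>
      (posExt_canonicalBD_nonempty φ).ne_empty (Set.subset_empty_iff.1 hφ)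
    simp only [h, iSup_false, iSup_bot]
    exact bot_lt_iff_ne_bot.2 (zero_ne_one (α := I)).symm

theorem canonicalModel_posExt {m : BDForm P → I} (hm : ∀ φ χ, BDValid φ χ → m φ ≤ m χ)
    (φ : BDForm P) : (canonicalModel m).π ((canonicalModel m).posExt φ) = m φ := by
  change (if (canonicalBD P).posExt φ = Set.univ then 1 else
    ⨆ χ, ⨆ (_ : (canonicalBD P).posExt χ ⊆ (canonicalBD P).posExt φ), m χ) = m φ
  rw [if_neg (posExt_canonicalBD_ne_univ φ)]
  refine le_antisymm (iSup₂_le fun χ hχ => hm _ _ (bdValid_of_canonicalBD hχ)) ?_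
  exact le_iSup₂ (f := fun χ (_ : (canonicalBD P).posExt χ ⊆ (canonicalBD P).posExt φ) => m χ)
    φ subset_rfl

theorem canonicalModel_negExt {m : BDForm P → I} (hm : ∀ φ χ, BDValid φ χ → m φ ≤ m χ)
    (φ : BDForm P) : (canonicalModel m).π ((canonicalModel m).negExt φ) = m φ.neg :=
  canonicalModel_posExt hm φ.neg

end Canonical

/-! ## Completeness -/

section Completeness

open OuterForm

variable {P : Type u}

instance : ExtendsCommonAx (MCBAx (P := P)) := ⟨.common _⟩

instance : ExtendsCommonAx (NMCBAx (P := P)) := ⟨.common _⟩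

theorem IsGodelHom.isGodelVal [Nonempty P] {Ax : OuterForm P → Prop} [ExtendsCommonAx Ax]
    {v : Lindenbaum Ax → I} (hv : IsGodelHom v) : IsGodelVal fun α => v (Lindenbaum.mk Ax α) := by
  have hiff : ∀ {α β : OuterForm P}, CommonAx (.iff α β) →
      Lindenbaum.mk Ax α = Lindenbaum.mk Ax β := fun h =>
    have h := Derives.common (Ax := Ax) h
    Lindenbaum.mk_eq_mk.2 ⟨h.and_left, h.and_right⟩
  exact
    { and := fun _ _ => hv.inf (Lindenbaum.mk Ax _) (Lindenbaum.mk Ax _)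
      or := fun _ _ => hv.sup (Lindenbaum.mk Ax _) (Lindenbaum.mk Ax _)
      imp := fun _ _ => hv.himp (Lindenbaum.mk Ax _) (Lindenbaum.mk Ax _)
      coimp := fun _ _ => hv.sdiff (Lindenbaum.mk Ax _) (Lindenbaum.mk Ax _)
      negNeg := fun α => congrArg v (hiff (.negNeg α))
      negAnd := fun α β => by
        rw [hiff (.negAnd α β), Lindenbaum.mk_or, hv.sup]
      negOr := fun α β => by
        rw [hiff (.negOr α β), Lindenbaum.mk_and, hv.inf] }

/-- A formula that is not derivable from `Γ` is separated from `Γ` by a Gödel valuation that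
validates all theorems. -/
theorem exists_isGodelVal_separating [Countable P] [Nonempty P] {Ax : OuterForm P → Prop}
    [ExtendsCommonAx Ax] {Γ : Set (OuterForm P)} {α : OuterForm P} (h : ¬Derives Ax Γ α) :
    ∃ e : OuterForm P → I, IsGodelVal e ∧ (∀ β γ, Derives Ax ∅ (imp β γ) → e β ≤ e γ) ∧
      e α < ⨅ γ ∈ Γ, e γ := by
  have : Countable (Lindenbaum Ax) := Quotient.countable
  obtain ⟨v, hv, c, hc1, hc2⟩ := exists_godelHom_separating Lindenbaum.prelinear
    Lindenbaum.coprelinear (Lindenbaum.theoryFilter (Ax := Ax) Γ)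
    (mt Lindenbaum.mk_mem_theoryFilter.1 h)
  refine ⟨_, hv.isGodelVal, fun β γ h => hv.monotone (Lindenbaum.mk_le_mk.2 h), ?_⟩
  exact hc1.trans_le
    (le_iInf₂ fun γ hγ => hc2 _ (Lindenbaum.mk_mem_theoryFilter.2 (.hyp hγ)))

/-- The truth lemma. Both coordinates are carried through the induction because `¬` swaps them. The
second is computed by pushing `¬` inwards with the negation axioms, down to `C (¬φ) ↔ ¬C φ`. -/
theorem valMCB_canonicalModel {e : OuterForm P → I} (he : IsGodelVal e)
    (hm : ∀ β γ, Derives MCBAx ∅ (imp β γ) → e β ≤ e γ) (α : LMCB P) :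
    (canonicalModel fun φ => e (C φ)).valMCB α = (e α, e (neg α)) := by
  have hiff : ∀ {β γ : OuterForm P}, MCBAx (.iff β γ) → e β = e γ := fun h =>
    have h := Derives.ax (Γ := ∅) h
    le_antisymm (hm _ _ h.and_left) (hm _ _ h.and_right)
  have hC : ∀ φ χ, BDValid φ χ → e (C φ) ≤ e (C χ) := fun φ χ h => hm _ _ (.ax (.bd φ χ h))
  induction α with
  | C φ =>
    rw [BeliefModel.valMCB, canonicalModel_posExt hC, canonicalModel_negExt hC, hiff (.negC φ)]
  | neg α ih => rw [BeliefModel.valMCB, ih, he.negNeg]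
  | and α β ih1 ih2 => rw [BeliefModel.valMCB, ih1, ih2, he.and, he.negAnd]
  | or α β ih1 ih2 => rw [BeliefModel.valMCB, ih1, ih2, he.or, he.negOr]
  | imp α β ih1 ih2 =>
    rw [BeliefModel.valMCB, ih1, ih2, he.imp, hiff (.negImp α β), he.coimp]
  | coimp α β ih1 ih2 =>
    rw [BeliefModel.valMCB, ih1, ih2, he.coimp, hiff (.negCoimp α β), he.imp]

theorem valNMCB_canonicalModel {e : OuterForm P → I} (he : IsGodelVal e)
    (hm : ∀ β γ, Derives NMCBAx ∅ (imp β γ) → e β ≤ e γ) (α : LNMCB P) :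
    (canonicalModel fun φ => e (C φ)).valNMCB α = (e α, e (neg α)) := by
  have hiff : ∀ {β γ : OuterForm P}, NMCBAx (.iff β γ) → e β = e γ := fun h =>
    have h := Derives.ax (Γ := ∅) h
    le_antisymm (hm _ _ h.and_left) (hm _ _ h.and_right)
  have hC : ∀ φ χ, BDValid φ χ → e (C φ) ≤ e (C χ) := fun φ χ h =>
    hm _ _ (Derives.ax (.bd φ χ h)).and_left
  have hnegC : ∀ φ, e (C φ.neg) = e (neg (C φ)) := fun φ =>
    have h := Derives.ax (Γ := ∅) (.negC φ)
    le_antisymm (hm _ _ h.and_left.and_left) (hm _ _ h.and_right.and_left)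
  induction α with
  | C φ =>
    rw [BeliefModel.valNMCB, canonicalModel_posExt hC, canonicalModel_negExt hC, hnegC]
  | neg α ih => rw [BeliefModel.valNMCB, ih, he.negNeg]
  | and α β ih1 ih2 => rw [BeliefModel.valNMCB, ih1, ih2, he.and, he.negAnd]
  | or α β ih1 ih2 => rw [BeliefModel.valNMCB, ih1, ih2, he.or, he.negOr]
  | imp α β ih1 ih2 =>
    rw [BeliefModel.valNMCB, ih1, ih2, he.imp, hiff (.negImp α β), he.and]
  | coimp α β ih1 ih2 =>
    rw [BeliefModel.valNMCB, ih1, ih2, he.coimp, hiff (.negCoimp α β), he.or]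

theorem BDForm.nonempty_var : BDForm P → Nonempty P
  | .var p => ⟨p⟩
  | .neg φ => φ.nonempty_var
  | .and φ _ => φ.nonempty_var
  | .or φ _ => φ.nonempty_var

/-- Without variables there are no formulas, so the conclusion of an entailment itself supplies the
variable from which `⊤` and `⊥` are built. -/
theorem OuterForm.nonempty_var : OuterForm P → Nonempty P
  | .C φ => φ.nonempty_var
  | .neg α => α.nonempty_var
  | .and α _ => α.nonempty_var
  | .or α _ => α.nonempty_var
  | .imp α _ => α.nonempty_var
  | .coimp α _ => α.nonempty_var

theorem MCBEntails.derives [Countable P] {Ψ : Set (LMCB P)} {α : LMCB P} (h : MCBEntails Ψ α) :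
    MCBDerives Ψ α := by
  by_contra hn
  have := α.nonempty_var
  obtain ⟨e, he, hm, hlt⟩ := exists_isGodelVal_separating hn
  -- The `e₁` half of the entailment is enough for derivability. The `e₂` half then follows by
  -- soundness.
  have hle := (h (canonicalModel fun φ => e (C φ))).1
  simp only [valMCB_canonicalModel he hm] at hle
  exact hlt.not_ge hle

theorem NMCBEntails.derives [Countable P] {Ω : Set (LNMCB P)} {β : LNMCB P}
    (h : NMCBEntails Ω β) : NMCBDerives Ω β := by
  by_contra hn
  have := β.nonempty_var
  obtain ⟨e, he, hm, hlt⟩ := exists_isGodelVal_separating hn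
  have hle := h (canonicalModel fun φ => e (C φ))
  simp only [valNMCB_canonicalModel he hm] at hle
  exact hlt.not_ge hle

end Completeness

theorem mainTheorem4 {P : Type u} [Countable P] :
    (∀ (Ψ : Set (LMCB P)) (α : LMCB P), MCBDerives Ψ α ↔ MCBEntails Ψ α) ∧
    (∀ (Ω : Set (LNMCB P)) (β : LNMCB P), NMCBDerives Ω β ↔ NMCBEntails Ω β) :=
  ⟨fun _ _ => ⟨MCBDerives.entails, MCBEntails.derives⟩,
    fun _ _ => ⟨NMCBDerives.entails, NMCBEntails.derives⟩⟩
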